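/- A language model $P$ over a finite vocabulary $V$ assigns to every finite context $c$ of tokens a probability distribution $P(\cdot\mid c)$ on $V$. In each context, order the tokens by decreasing probability, tokens of equal probability being ordered by an arbitrary fixed strict total order $\prec_c$ on $V$. For a text $w_1\cdots w_T$ and $1\le i\le T$, let $c_i=w_1\cdots w_{i-1}$, let $$V_i^+=\{v\in V: P(v\mid c_i)>P(w_i\mid c_i)\ \text{ or }\ (P(v\mid c_i)=P(w_i\mid c_i)\text{ and } v\prec_{c_i} w_i)\}$$ be the set of tokens that precede $w_i$ in this order, and put $a_i=\sum_{v\in V_i^+}P(v\mid c_i)$ and $b_i=a_i+P(w_i\mid c_i)$. The DMAP sample of the text with evaluator model $P$ is the sequence $x_1,\dots,x_T$ in which, given the text, the $x_i$ are drawn independently from the uniform distributions on the intervals $[a_i,b_i]$. Let $k\ge 1$ be a fixed number of bins. For every $T$ let the text $w_1\cdots w_T$ be generated by pure sampling from $P$ (each $w_i$ is drawn from $P(\cdot\mid w_1\cdots w_{i-1})$), let $x_1,\dots,x_T$ be its DMAP sample with the same model $P$ as evaluator, and set $$f_i=\frac{\#\{j\in\{1,\dots,T\}:\frac{i-1}{k}\le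 x_j<\frac{i}{k}\}}{T}\quad(1\le i\le k),\qquad \chi^2=Tk\sum_{i=1}^k\Bigl(f_i-\frac1k\Bigr)^2 .$$ Then, as $T\to\infty$, the statistic $\chi^2$ converges in distribution to the $\chi^2_{k-1}$ distribution, the law of the sum of the squares of $k-1$ independent standard normal variables (the point mass at $0$ if $k=1$). -/

import Mathlib

open MeasureTheory ProbabilityTheory Filter

namespace DMAP

/-- A language model over the vocabulary `V`: to every context (a finite sequence of tokens) it
assigns a probability distribution `p(· | context)` for the next token. -/
abbrev LanguageModel (V : Type*) := List V → PMF V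

/-- Pure (autoregressive) sampling: the law of the text `w₁ ⋯ w_T` in which each next token is
drawn from `P(· | w₁ ⋯ w_{i-1})`. -/
noncomputable def textLaw {V : Type*} (P : LanguageModel V) : (T : ℕ) → PMF (Fin T → V)
  | 0 => PMF.pure Fin.elim0
  | T + 1 => (textLaw P T).bind fun w =>
      (P (List.ofFn w)).map fun v => Fin.snoc (α := fun _ => V) w v

/-- The context preceding the token at position `i` (positions are counted from `0`). -/
def context {V : Type*} {T : ℕ} (w : Fin T → V) (i : Fin T) : List V :=
  (List.ofFn w).take i

open Classical in
/-- The set `V⁺` of tokens placed before `w` when the tokens are ordered by decreasing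
probability in the context `c`. Equally likely tokens are ordered by `tie c`. -/
noncomputable def moreLikely {V : Type*} [Fintype V] (P : LanguageModel V)
    (tie : List V → V → V → Prop) (c : List V) (w : V) : Finset V :=
  Finset.univ.filter fun v => P c w < P c v ∨ (P c v = P c w ∧ tie c v w)

/-- The left end point `a` of the interval attached to the token `w` in the context `c`. -/
noncomputable def leftEnd {V : Type*} [Fintype V] (P : LanguageModel V)
    (tie : List V → V → V → Prop) (c : List V) (w : V) : ℝ :=
  ∑ v ∈ moreLikely P tie c w, (P c v).toReal

/-- The right end point `b = a + p(w | c)` of the interval attached to `w` in the context `c`. -/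
noncomputable def rightEnd {V : Type*} [Fintype V] (P : LanguageModel V)
    (tie : List V → V → V → Prop) (c : List V) (w : V) : ℝ :=
  leftEnd P tie c w + (P c w).toReal

open Classical in
/-- If no two distinct tokens share a positive probability, the tie-breaking order plays no role:
`a` is the total mass of the tokens that are strictly more likely than `w`. -/
theorem leftEnd_eq_of_no_ties {V : Type*} [Fintype V] (P : LanguageModel V)
    (tie : List V → V → V → Prop) (c : List V) (htie : ∀ v, ¬ tie c v v)
    (h : ∀ v w, P c v = P c w → P c v ≠ 0 → v = w) (w : V) :
    leftEnd P tie c w = ∑ v ∈ Finset.univ.filter (fun v => P c w < P c v), (P c v).toReal := by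
  unfold leftEnd moreLikely
  symm
  apply Finset.sum_subset
  · intro v hv
    simp only [Finset.mem_filter, Finset.mem_univ, true_and] at hv ⊢
    exact Or.inl hv
  · intro v hv hv'
    simp only [Finset.mem_filter, Finset.mem_univ, true_and] at hv hv'
    rcases hv with hv | ⟨he, ht⟩
    · exact absurd hv hv'
    · by_cases h0 : P c v = 0
      · simp [h0]
      · have hvw := h v w he h0
        subst hvw
        exact absurd ht (htie v)

/-- The uniform distribution on the interval `[a, b]` (the point mass at `a` if `b ≤ a`). -/
noncomputable def uniformIcc (a b : ℝ) : Measure ℝ :=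
  open Classical in if a < b then cond volume (Set.Icc a b) else Measure.dirac a

instance (a b : ℝ) : IsProbabilityMeasure (uniformIcc a b) := by
  unfold uniformIcc
  split_ifs with h
  · exact cond_isProbabilityMeasure_of_finite (by simp [h]) (by simp)
  · infer_instance

/-- The law of the DMAP sample `x₁ ⋯ x_T` of a fixed text `w` with evaluator model `P`: the points
`x_i` are drawn independently from the uniform distributions on the intervals `I_i`. -/
noncomputable def sampleLaw {V : Type*} [Fintype V] (P : LanguageModel V)
    (tie : List V → V → V → Prop) {T : ℕ} (w : Fin T → V) : Measure (Fin T → ℝ) :=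
  Measure.pi fun i => uniformIcc (leftEnd P tie (context w i) (w i))
    (rightEnd P tie (context w i) (w i))

/-- The law of the DMAP sample, with evaluator model `P`, of a random text of length `T` generated
by pure sampling from the model `G`. -/
noncomputable def generatedSampleLaw {V : Type*} [Fintype V] (G P : LanguageModel V)
    (tie : List V → V → V → Prop) (T : ℕ) : Measure (Fin T → ℝ) :=
  ∑ w : Fin T → V, textLaw G T w • sampleLaw P tie w

instance {V : Type*} [Fintype V] (G P : LanguageModel V)
    (tie : List V → V → V → Prop) (T : ℕ) :
    IsProbabilityMeasure (generatedSampleLaw G P tie T) where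
  measure_univ := by
    have h : ∀ w : Fin T → V, sampleLaw P tie w Set.univ = 1 := fun w => by
      unfold sampleLaw
      exact measure_univ
    have h1 := (textLaw G T).tsum_coe
    rw [tsum_fintype] at h1
    simp [generatedSampleLaw, Measure.finsetSum_apply, h, h1]

/-- The proportion of the points `x` in the bin `[i/k, (i+1)/k)`, for `i = 0, …, k - 1`. -/
noncomputable def binFrequency (k : ℕ) {T : ℕ} (x : Fin T → ℝ) (i : Fin k) : ℝ :=
  ((Finset.univ.filter fun j : Fin T =>
    (i : ℝ) / k ≤ x j ∧ x j < ((i : ℝ) + 1) / k).card : ℝ) / T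

/-- Pearson's statistic `χ² = T k ∑ᵢ (fᵢ - 1/k)²`. -/
noncomputable def pearsonStatistic (k : ℕ) {T : ℕ} (x : Fin T → ℝ) : ℝ :=
  (T : ℝ) * k * ∑ i : Fin k, (binFrequency k x i - 1 / (k : ℝ)) ^ 2

/-- The `χ²` distribution with `n` degrees of freedom: the law of the sum of the squares of `n`
independent standard normal random variables (the point mass at `0` if `n = 0`). -/
noncomputable def chiSquared (n : ℕ) : Measure ℝ :=
  (Measure.pi fun _ : Fin n => gaussianReal 0 1).map fun z => ∑ i, z i ^ 2

instance (n : ℕ) : IsProbabilityMeasure (chiSquared n) :=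
  Measure.isProbabilityMeasure_map (Measurable.aemeasurable (by fun_prop))

end DMAP

namespace DMAP

open scoped RealInnerProductSpace

/-! ### The token intervals tile the unit interval. -/

section Intervals

variable {V : Type*} [Fintype V] (P : LanguageModel V) (tie : List V → V → V → Prop)
  (c : List V)

/-! In a fixed context the token intervals tile `[0, 1)` up to a null set, and each has length equal
to its token's probability. A point uniform in the interval of a sampled token is therefore uniform
on `[0, 1)`, whatever the context. Induction on the length makes the sample i.i.d. uniform
(`generatedSampleLaw_self`), and Pearson's theorem for `k` equal cells remains.

Send each point to `√k` times the projection of its bin's coordinate vector to the hyperplane of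
zero sum. For a uniform point this vector has mean zero and identity covariance, so the normalized
sums converge to the standard Gaussian of the hyperplane
(`tendstoInDistribution_inv_sqrt_smul_sum`). Their squared norm is almost surely the statistic
(`norm_sq_inv_sqrt_smul_sum_pointVector`); that of the Gaussian has the law `chiSquared (k - 1)`, as
the hyperplane has dimension `k - 1`. -/

theorem sum_toReal_eq_one : ∑ v, (P c v).toReal = 1 := by
  have h := (P c).tsum_coe
  rw [tsum_fintype] at h
  rw [← ENNReal.toReal_sum fun v _ => (P c).apply_ne_top v, h, ENNReal.toReal_one]

theorem leftEnd_nonneg (w : V) : 0 ≤ leftEnd P tie c w :=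
  Finset.sum_nonneg fun _ _ => ENNReal.toReal_nonneg

theorem volume_Ico_leftEnd_rightEnd (w : V) :
    volume (Set.Ico (leftEnd P tie c w) (rightEnd P tie c w)) = P c w := by
  rw [Real.volume_Ico, rightEnd, add_sub_cancel_left, ENNReal.ofReal_toReal ((P c).apply_ne_top w)]

/-- The factor `P c w` cancels the normalization of the uniform law, and kills the point mass when
the token has probability zero. Half-open intervals differ from closed ones by a null set and are
genuinely disjoint. -/
theorem smul_uniformIcc (w : V) :
    P c w • uniformIcc (leftEnd P tie c w) (rightEnd P tie c w) =
      volume.restrict (Set.Ico (leftEnd P tie c w) (rightEnd P tie c w)) := by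
  have hvol := volume_Ico_leftEnd_rightEnd P tie c w
  by_cases h : leftEnd P tie c w < rightEnd P tie c w
  · have h0 : P c w ≠ 0 := by
      rintro h0
      simp [rightEnd, h0] at h
    rw [uniformIcc, if_pos h, ProbabilityTheory.cond, ← measure_congr Ico_ae_eq_Icc, hvol, smul_smul,
      ENNReal.mul_inv_cancel h0 ((P c).apply_ne_top w), one_smul,
      Measure.restrict_congr_set Ico_ae_eq_Icc]
  · rw [Set.Ico_eq_empty h] at hvol ⊢
    rw [← hvol]
    simp

variable [IsStrictTotalOrder V (tie c)]

theorem notMem_moreLikely_self (w : V) : w ∉ moreLikely P tie c w := by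
  simp [moreLikely, irrefl_of (tie c) w]

/-- Transitivity of the token order; it makes the interval of an earlier token end before that of a
later one begins. -/
theorem insert_moreLikely_subset [DecidableEq V] {v w : V} (h : v ∈ moreLikely P tie c w) :
    insert v (moreLikely P tie c v) ⊆ moreLikely P tie c w := by
  intro u hu
  rcases Finset.mem_insert.1 hu with rfl | hu
  · exact h
  simp only [moreLikely, Finset.mem_filter, Finset.mem_univ, true_and] at h hu ⊢
  rcases h with h | ⟨h, ht⟩ <;> rcases hu with hu | ⟨hu, hut⟩
  · exact Or.inl (h.trans hu)
  · exact Or.inl (hu ▸ h)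
  · exact Or.inl (h ▸ hu)
  · exact Or.inr ⟨hu.trans h, trans_of (tie c) hut ht⟩

theorem mem_moreLikely_or_mem_moreLikely {v w : V} (h : v ≠ w) :
    v ∈ moreLikely P tie c w ∨ w ∈ moreLikely P tie c v := by
  simp only [moreLikely, Finset.mem_filter, Finset.mem_univ, true_and]
  rcases lt_trichotomy (P c v) (P c w) with hlt | heq | hlt
  · exact Or.inr (Or.inl hlt)
  · rcases trichotomous_of (tie c) v w with ht | ht | ht
    · exact Or.inl (Or.inr ⟨heq, ht⟩)
    · exact absurd ht h
    · exact Or.inr (Or.inr ⟨heq.symm, ht⟩)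
  · exact Or.inl (Or.inl hlt)

theorem rightEnd_eq_sum [DecidableEq V] (w : V) :
    rightEnd P tie c w = ∑ v ∈ insert w (moreLikely P tie c w), (P c v).toReal := by
  rw [Finset.sum_insert (notMem_moreLikely_self P tie c w), rightEnd, leftEnd, add_comm]

theorem rightEnd_le_leftEnd {v w : V} (h : v ∈ moreLikely P tie c w) :
    rightEnd P tie c v ≤ leftEnd P tie c w := by
  classical
  rw [rightEnd_eq_sum]
  exact Finset.sum_le_sum_of_subset_of_nonneg (insert_moreLikely_subset P tie c h)
    fun _ _ _ => ENNReal.toReal_nonneg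

theorem rightEnd_le_one (w : V) : rightEnd P tie c w ≤ 1 := by
  classical
  rw [rightEnd_eq_sum, ← sum_toReal_eq_one P c]
  exact Finset.sum_le_sum_of_subset_of_nonneg (Finset.subset_univ _)
    fun _ _ _ => ENNReal.toReal_nonneg

theorem pairwise_disjoint_Ico :
    Pairwise (Function.onFun Disjoint
      fun v => Set.Ico (leftEnd P tie c v) (rightEnd P tie c v)) := by
  intro v w h
  rw [Function.onFun, Set.disjoint_left]
  rintro x ⟨hv, hv'⟩ ⟨hw, hw'⟩
  rcases mem_moreLikely_or_mem_moreLikely P tie c h with h | h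
  · linarith [rightEnd_le_leftEnd P tie c h]
  · linarith [rightEnd_le_leftEnd P tie c h]

/-- Choosing a token according to the model and then a uniform point of its interval yields a
uniform point of the unit interval. -/
theorem sum_smul_uniformIcc :
    ∑ w, P c w • uniformIcc (leftEnd P tie c w) (rightEnd P tie c w) =
      volume.restrict (Set.Ico (0 : ℝ) 1) := by
  simp_rw [smul_uniformIcc]
  rw [← Measure.sum_fintype, ← Measure.restrict_iUnion (pairwise_disjoint_Ico P tie c)
    fun _ => measurableSet_Ico]
  -- The union lies in `[0, 1)` and already has measure 1, so the two sets agree almost everywhere.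
  refine Measure.restrict_congr_set (ae_eq_of_subset_of_measure_ge ?_ ?_ ?_ ?_)
  · refine Set.iUnion_subset fun w => Set.Ico_subset_Ico ?_ ?_
    · exact leftEnd_nonneg P tie c w
    · exact rightEnd_le_one P tie c w
  · rw [measure_iUnion (pairwise_disjoint_Ico P tie c) fun _ => measurableSet_Ico]
    simp_rw [volume_Ico_leftEnd_rightEnd, (P c).tsum_coe]
    simp
  · exact (MeasurableSet.iUnion fun _ => measurableSet_Ico).nullMeasurableSet
  · simp

end Intervals

/-! ### The law of the sample by induction on the text length. -/

section Law

variable {V : Type*}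

theorem textLaw_snoc (P : LanguageModel V) (T : ℕ) (w : Fin T → V) (v : V) :
    textLaw P (T + 1) (Fin.snoc (α := fun _ => V) w v) = textLaw P T w * P (List.ofFn w) v := by
  classical
  rw [textLaw, PMF.bind_apply, tsum_eq_single w, PMF.map_apply, tsum_eq_single v]
  · simp
  · intro u hu
    rw [if_neg]
    exact fun h => hu (Fin.snoc_right_injective _ h).symm
  · intro u hu
    rw [PMF.map_apply, ENNReal.tsum_eq_zero.2, mul_zero]
    intro y
    rw [if_neg]
    intro h
    exact hu (by simpa using (congrArg (Fin.init (α := fun _ => V)) h).symm)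

theorem ofFn_snoc {T : ℕ} (w : Fin T → V) (v : V) :
    List.ofFn (Fin.snoc (α := fun _ => V) w v) = List.ofFn w ++ [v] := by
  rw [List.ofFn_succ']
  simp

theorem context_snoc_castSucc {T : ℕ} (w : Fin T → V) (v : V) (i : Fin T) :
    context (Fin.snoc (α := fun _ => V) w v) i.castSucc = context w i := by
  rw [context, context, ofFn_snoc, List.take_append_of_le_length]
  · simp
  · simp [i.2.le]

theorem context_snoc_last {T : ℕ} (w : Fin T → V) (v : V) :
    context (Fin.snoc (α := fun _ => V) w v) (Fin.last T) = List.ofFn w := by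
  rw [context, ofFn_snoc, List.take_append_of_le_length] <;> simp

/-- The DMAP sample of a text generated by its own evaluator is an independent uniform sample of
the unit interval. -/
theorem generatedSampleLaw_self [Fintype V] (P : LanguageModel V)
    (tie : List V → V → V → Prop) (htie : ∀ c, IsStrictTotalOrder V (tie c)) (T : ℕ) :
    generatedSampleLaw P P tie T =
      Measure.pi fun _ : Fin T => volume.restrict (Set.Ico (0 : ℝ) 1) := by
  symm
  refine Measure.pi_eq fun s hs => ?_
  simp only [generatedSampleLaw, sampleLaw, Measure.finsetSum_apply, Measure.smul_apply,
    Measure.pi_pi, smul_eq_mul]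
  induction T with
  | zero =>
    rw [Fintype.sum_eq_single Fin.elim0 fun w hw => absurd (Subsingleton.elim _ _) hw]
    simp [textLaw]
  | succ T ih =>
    rw [← (Fin.snocEquiv fun _ : Fin (T + 1) => V).sum_comp, Fintype.sum_prod_type_right,
      Fin.prod_univ_castSucc, ← ih (fun i => s i.castSucc) fun i => hs i.castSucc, Finset.sum_mul]
    refine Finset.sum_congr rfl fun w _ => ?_
    have := htie (List.ofFn w)
    -- The uniform law of the last point does not depend on the context, so it may be expanded over
    -- the tokens following `w`.
    rw [← sum_smul_uniformIcc P tie (List.ofFn w), Measure.finsetSum_apply, Finset.mul_sum]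
    refine Finset.sum_congr rfl fun v _ => ?_
    rw [Fin.prod_univ_castSucc]
    change textLaw P (T + 1) (Fin.snoc (α := fun _ => V) w v) * _ = _
    rw [textLaw_snoc]
    simp only [Fin.snocEquiv, Equiv.coe_fn_mk, context_snoc_castSucc, context_snoc_last,
      Fin.snoc_castSucc, Fin.snoc_last, Measure.smul_apply, smul_eq_mul]
    ring

end Law

/-! ### The multivariate central limit theorem via characteristic functions. -/

section CentralLimit

variable {α E : Type*} [MeasurableSpace α] [NormedAddCommGroup E] [InnerProductSpace ℝ E]
  [FiniteDimensional ℝ E] [MeasurableSpace E] [BorelSpace E]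

theorem charFun_map_pi_smul_sum (ν : Measure α) [IsProbabilityMeasure ν] {g : α → E}
    (hg : Measurable g) (T : ℕ) (r : ℝ) (t : E) :
    charFun ((Measure.pi fun _ : Fin T => ν).map fun y => r • ∑ j, g (y j)) t =
      (∫ y, Complex.exp ((r * ⟪g y, t⟫ : ℝ) * Complex.I) ∂ν) ^ T := by
  rw [charFun_apply, integral_map (Measurable.aemeasurable (by fun_prop)) (by fun_prop)]
  simp_rw [real_inner_smul_left, sum_inner, Finset.mul_sum, Complex.ofReal_sum, Finset.sum_mul,
    Complex.exp_sum]
  rw [integral_fintype_prod_eq_prod (𝕜 := ℂ)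
    (f := fun (_ : Fin T) y => Complex.exp ((r * ⟪g y, t⟫ : ℝ) * Complex.I))]
  simp

/-- The central limit theorem for independent identically distributed vectors with mean zero and
identity covariance. -/
theorem tendstoInDistribution_inv_sqrt_smul_sum {ν : Measure α} [IsProbabilityMeasure ν]
    {g : α → E} (hg : Measurable g) (hmean : ∀ t, ∫ y, ⟪g y, t⟫ ∂ν = 0)
    (hcov : ∀ t, ∫ y, ⟪g y, t⟫ ^ 2 ∂ν = ‖t‖ ^ 2)
    {Ω : ℕ → Type*} [∀ T, MeasurableSpace (Ω T)]
    (μ : (T : ℕ) → Measure (Ω T)) [∀ T, IsProbabilityMeasure (μ T)]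
    (x : (T : ℕ) → Ω T → Fin T → α)
    (hx : ∀ T, HasLaw (x T) (Measure.pi fun _ : Fin T => ν) (μ T)) :
    TendstoInDistribution (fun (T : ℕ) ω => (√(T : ℝ))⁻¹ • ∑ j, g (x T ω j)) atTop
      (fun y : E => y) μ (stdGaussian E) where
  forall_aemeasurable T :=
    Measurable.comp_aemeasurable (g := fun y : Fin T → α => (√(T : ℝ))⁻¹ • ∑ j, g (y j))
      (by fun_prop) (hx T).aemeasurable
  tendsto := by
    refine ProbabilityMeasure.tendsto_iff_tendsto_charFun.2 fun t => ?_
    have hmap (T : ℕ) : (μ T).map (fun ω => (√(T : ℝ))⁻¹ • ∑ j, g (x T ω j)) =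
        (Measure.pi fun _ : Fin T => ν).map fun y => (√(T : ℝ))⁻¹ • ∑ j, g (y j) := by
      rw [← (hx T).map_eq, AEMeasurable.map_map_of_aemeasurable
        (Measurable.aemeasurable (by fun_prop)) (hx T).aemeasurable]
      rfl
    simp only [ProbabilityMeasure.coe_mk, hmap, charFun_map_pi_smul_sum ν hg, Measure.map_id',
      charFun_stdGaussian]
    rcases eq_or_ne t 0 with rfl | ht
    · simp
    have ht' : ‖t‖ ≠ 0 := norm_ne_zero_iff.2 ht
    -- The projection to the direction of `t` has mean 0 and variance 1, so the scalar limit at the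
    -- argument `‖t‖` is the one sought.
    have key := tendsto_charFun_inv_sqrt_mul_pow (P := ν) (X := fun y => ⟪g y, t⟫ / ‖t‖)
      (Measurable.aemeasurable (by fun_prop)) (by rw [integral_div, hmean, zero_div])
      (by simp only [Pi.pow_apply, div_pow]
          rw [integral_div, hcov, div_self (pow_ne_zero 2 ht')]) ‖t‖
    refine key.congr fun T => ?_
    rw [charFun_apply_real, integral_map (Measurable.aemeasurable (by fun_prop)) (by fun_prop)]
    congr 2
    ext y
    congr 2
    push_cast
    field_simp [Complex.ofReal_ne_zero.2 ht']

end CentralLimit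

/-! ### The squared norm of a standard Gaussian vector. -/

section ChiSquared

theorem map_norm_sq_stdGaussian {E : Type*} [NormedAddCommGroup E] [InnerProductSpace ℝ E]
    [FiniteDimensional ℝ E] [MeasurableSpace E] [BorelSpace E] {n : ℕ}
    (hn : Module.finrank ℝ E = n) :
    (stdGaussian E).map (fun y => ‖y‖ ^ 2) = chiSquared n := by
  subst hn
  rw [stdGaussian_eq_map_pi_orthonormalBasis (stdOrthonormalBasis ℝ E),
    Measure.map_map (by fun_prop) (by fun_prop), chiSquared]
  congr 1
  ext z
  rw [Function.comp_apply, ← (stdOrthonormalBasis ℝ E).sum_sq_norm_inner_right]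
  simp [inner_sum, inner_smul_right, orthonormal_iff_ite.1 (stdOrthonormalBasis ℝ E).orthonormal]

end ChiSquared

/-! ### Bins of a uniform point. -/

section Bins

/-- The `i`-th of the `k` bins that partition the unit interval. -/
def bin (k : ℕ) (i : Fin k) : Set ℝ := Set.Ico ((i : ℝ) / k) (((i : ℝ) + 1) / k)

theorem measurableSet_bin (k : ℕ) (i : Fin k) : MeasurableSet (bin k i) := measurableSet_Ico

theorem mem_bin_iff {k : ℕ} {y : ℝ} (hy : 0 ≤ y) (i : Fin k) : y ∈ bin k i ↔ ⌊y * k⌋₊ = i := by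
  have hk : (0 : ℝ) < k := by exact_mod_cast i.pos
  rw [Nat.floor_eq_iff (by positivity), bin, Set.mem_Ico, div_le_iff₀ hk, lt_div_iff₀ hk]

theorem sum_indicator_bin {M : Type*} [AddCommMonoid M] {k : ℕ} (hk : 1 ≤ k) {y : ℝ}
    (hy : y ∈ Set.Ico (0 : ℝ) 1) :
    ∃ i₀ : Fin k, ∀ q : Fin k → M, ∑ i, (bin k i).indicator (fun _ => q i) y = q i₀ := by
  have hk' : (0 : ℝ) < k := by exact_mod_cast hk
  have hlt : ⌊y * k⌋₊ < k := by
    rw [Nat.floor_lt (mul_nonneg hy.1 hk'.le)]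
    exact mul_lt_of_lt_one_left hk' hy.2
  refine ⟨⟨_, hlt⟩, fun q => ?_⟩
  rw [Fintype.sum_eq_single ⟨_, hlt⟩, Set.indicator_of_mem]
  · rw [mem_bin_iff hy.1]
  · intro i hi
    rw [Set.indicator_of_notMem]
    rw [mem_bin_iff hy.1]
    exact fun h => hi (Fin.ext h.symm)

theorem measureReal_bin {k : ℕ} (i : Fin k) :
    (volume.restrict (Set.Ico (0 : ℝ) 1)).real (bin k i) = 1 / k := by
  have hk : (0 : ℝ) < k := by exact_mod_cast i.pos
  have hi : (i : ℝ) + 1 ≤ k := by exact_mod_cast i.2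
  have hsub : bin k i ⊆ Set.Ico 0 1 :=
    Set.Ico_subset_Ico (by positivity) ((div_le_one hk).2 hi)
  rw [measureReal_restrict_apply (measurableSet_bin k i), Set.inter_eq_left.2 hsub, bin,
    Real.volume_real_Ico_of_le (by gcongr; linarith)]
  ring

/-- The mean over a uniform point of a function of its bin. -/
theorem integral_comp_sum_indicator_bin {M : Type*} [AddCommMonoid M] {k : ℕ} (hk : 1 ≤ k)
    (q : Fin k → M) (f : M → ℝ) :
    ∫ y, f (∑ i, (bin k i).indicator (fun _ => q i) y) ∂volume.restrict (Set.Ico (0 : ℝ) 1) =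
      (∑ i, f (q i)) / k := by
  have h : ∀ᵐ y ∂volume.restrict (Set.Ico (0 : ℝ) 1),
      f (∑ i, (bin k i).indicator (fun _ => q i) y) =
        ∑ i, (bin k i).indicator (fun _ => f (q i)) y := by
    filter_upwards [ae_restrict_mem measurableSet_Ico] with y hy
    classical
    have hk' : (0 : ℝ) < k := by exact_mod_cast hk
    -- Working with pairs ensures that the same bin index serves `q` and `f ∘ q`; no condition on `f
    -- 0` is needed.
    obtain ⟨i₀, hi₀⟩ := sum_indicator_bin (M := M × ℝ) hk hy
    have := hi₀ fun i => (q i, f (q i))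
    have h1 := congrArg Prod.fst this
    have h2 := congrArg Prod.snd this
    simp only [Prod.fst_sum, Prod.snd_sum, Set.indicator_apply, apply_ite Prod.fst,
      apply_ite Prod.snd, Prod.fst_zero, Prod.snd_zero] at h1 h2 ⊢
    rw [h1, h2]
  rw [integral_congr_ae h, integral_finsetSum _ fun i _ =>
    (integrable_const _).indicator (measurableSet_bin k i)]
  simp_rw [integral_indicator_const _ (measurableSet_bin k _), measureReal_bin, smul_eq_mul]
  rw [← Finset.mul_sum]
  ring

end Bins

/-! ### Pearson's statistic as a squared norm. -/

section BinVector

/-- The vectors whose coordinates sum to zero. -/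
noncomputable abbrev zeroSum (k : ℕ) : Submodule ℝ (EuclideanSpace ℝ (Fin k)) :=
  (ℝ ∙ (WithLp.toLp 2 fun _ => (1 : ℝ)))ᗮ

theorem mem_zeroSum_iff {k : ℕ} (t : EuclideanSpace ℝ (Fin k)) :
    t ∈ zeroSum k ↔ ∑ i, t i = 0 := by
  rw [Submodule.mem_orthogonal_singleton_iff_inner_right]
  simp [PiLp.inner_apply]

theorem finrank_zeroSum {k : ℕ} (hk : 1 ≤ k) : Module.finrank ℝ (zeroSum k) = k - 1 := by
  have hne : (WithLp.toLp 2 fun _ => (1 : ℝ) : EuclideanSpace ℝ (Fin k)) ≠ 0 := by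
    intro h
    simpa using congrArg (fun t => t ⟨0, hk⟩) h
  have h := (ℝ ∙ (WithLp.toLp 2 fun _ => (1 : ℝ) :
    EuclideanSpace ℝ (Fin k))).finrank_add_finrank_orthogonal
  rw [finrank_span_singleton hne, finrank_euclideanSpace_fin] at h
  exact Nat.eq_sub_of_add_eq' h

/-- The normalized projection of the `i`-th coordinate vector to the vectors of zero sum. -/
noncomputable def binVector (k : ℕ) (i : Fin k) : zeroSum k :=
  √(k : ℝ) • (zeroSum k).orthogonalProjectionOnto (EuclideanSpace.single i 1)

/-- The projection drops out against a vector already in the hyperplane. Both moments of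
`pointVector` follow from this. -/
theorem inner_binVector {k : ℕ} (i : Fin k) (t : zeroSum k) :
    ⟪binVector k i, t⟫ = √(k : ℝ) * (t : EuclideanSpace ℝ (Fin k)) i := by
  rw [binVector, real_inner_smul_left, Submodule.inner_orthogonalProjectionOnto_eq_of_mem_right,
    EuclideanSpace.inner_single_left]
  simp

/-- The vector attached to the bin of a point of the unit interval. -/
noncomputable def pointVector (k : ℕ) (y : ℝ) : zeroSum k :=
  ∑ i, (bin k i).indicator (fun _ => binVector k i) y

theorem measurable_pointVector (k : ℕ) : Measurable (pointVector k) :=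
  Finset.measurable_fun_sum _ fun i _ => measurable_const.indicator (measurableSet_bin k i)

theorem integral_inner_pointVector {k : ℕ} (hk : 1 ≤ k) (t : zeroSum k) :
    ∫ y, ⟪pointVector k y, t⟫ ∂volume.restrict (Set.Ico (0 : ℝ) 1) = 0 := by
  rw [show ∫ y, ⟪pointVector k y, t⟫ ∂volume.restrict (Set.Ico (0 : ℝ) 1) = _ from
    integral_comp_sum_indicator_bin hk (binVector k) fun u => ⟪u, t⟫]
  simp_rw [inner_binVector]
  rw [← Finset.mul_sum, (mem_zeroSum_iff _).1 t.2]
  simp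

/-- The square of the factor `√k` in `binVector` cancels the bin probability `1 / k`. -/
theorem integral_inner_pointVector_sq {k : ℕ} (hk : 1 ≤ k) (t : zeroSum k) :
    ∫ y, ⟪pointVector k y, t⟫ ^ 2 ∂volume.restrict (Set.Ico (0 : ℝ) 1) = ‖t‖ ^ 2 := by
  rw [show ∫ y, ⟪pointVector k y, t⟫ ^ 2 ∂volume.restrict (Set.Ico (0 : ℝ) 1) = _ from
    integral_comp_sum_indicator_bin hk (binVector k) fun u => ⟪u, t⟫ ^ 2]
  have hk' : (k : ℝ) ≠ 0 := by positivity
  simp_rw [inner_binVector, mul_pow, Real.sq_sqrt (Nat.cast_nonneg k)]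
  rw [← Finset.mul_sum, mul_div_cancel_left₀ _ hk', Submodule.coe_norm,
    EuclideanSpace.real_norm_sq_eq]

theorem natCast_mul_binFrequency {k T : ℕ} (x : Fin T → ℝ) (i : Fin k) :
    T * binFrequency k x i = ∑ j, (bin k i).indicator (fun _ => (1 : ℝ)) (x j) := by
  rcases eq_or_ne T 0 with rfl | hT
  · simp
  rw [binFrequency, mul_div_cancel₀ _ (Nat.cast_ne_zero.2 hT), Finset.card_filter]
  push_cast
  exact Finset.sum_congr rfl fun j _ => by simp [Set.indicator_apply, bin]

/-- Pearson's statistic is the squared length of the normalized sum of the vectors attached to the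
sample points. -/
theorem norm_sq_inv_sqrt_smul_sum_pointVector {k : ℕ} (hk : 1 ≤ k) {T : ℕ} {x : Fin T → ℝ}
    (hx : ∀ j, x j ∈ Set.Ico (0 : ℝ) 1) :
    ‖(√(T : ℝ))⁻¹ • ∑ j, pointVector k (x j)‖ ^ 2 = pearsonStatistic k x := by
  rcases eq_or_ne T 0 with rfl | hT
  · simp [pearsonStatistic]
  have hT' : (T : ℝ) ≠ 0 := Nat.cast_ne_zero.2 hT
  have hk' : (k : ℝ) ≠ 0 := by positivity
  have htotal : ∑ i, binFrequency k x i = 1 := by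
    apply mul_left_cancel₀ hT'
    simp_rw [Finset.mul_sum, natCast_mul_binFrequency]
    rw [Finset.sum_comm, Finset.sum_congr rfl fun j _ =>
      (sum_indicator_bin (M := ℝ) hk (hx j)).choose_spec fun _ => 1]
    simp
  set d : EuclideanSpace ℝ (Fin k) := WithLp.toLp 2 fun i => binFrequency k x i - 1 / k with hd
  have hdmem : d ∈ zeroSum k := by
    rw [mem_zeroSum_iff]
    simp [hd, htotal, hk']
  have hsum : ∑ j, pointVector k (x j) = ((T : ℝ) * √(k : ℝ)) • (⟨d, hdmem⟩ : zeroSum k) := by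
    refine ext_inner_right ℝ fun t => ?_
    have h0 := (mem_zeroSum_iff _).1 t.2
    have h1 (j : Fin T) (i : Fin k) :
        ⟪(bin k i).indicator (fun _ => binVector k i) (x j), t⟫ =
          (bin k i).indicator (fun _ => (1 : ℝ)) (x j) *
            (√(k : ℝ) * (t : EuclideanSpace ℝ (Fin k)) i) := by
      by_cases h : x j ∈ bin k i
      · rw [Set.indicator_of_mem h, Set.indicator_of_mem h, inner_binVector, one_mul]
      · rw [Set.indicator_of_notMem h, Set.indicator_of_notMem h, inner_zero_left, zero_mul]
    simp_rw [pointVector, sum_inner, h1]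
    rw [Finset.sum_comm, real_inner_smul_left, Submodule.coe_inner, PiLp.inner_apply]
    simp_rw [← Finset.sum_mul, ← natCast_mul_binFrequency]
    -- Centring at `1 / k` is invisible to vectors of zero sum.
    have h2 : ∑ i, (1 / k : ℝ) * (t : EuclideanSpace ℝ (Fin k)) i = 0 := by
      rw [← Finset.mul_sum, h0, mul_zero]
    simp only [hd, RCLike.inner_apply, conj_trivial]
    simp_rw [mul_sub, Finset.sum_sub_distrib, mul_comm _ (1 / k : ℝ), h2, sub_zero,
      Finset.mul_sum]
    exact Finset.sum_congr rfl fun i _ => by ring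
  rw [hsum, smul_smul, norm_smul, mul_pow, Submodule.coe_norm, EuclideanSpace.real_norm_sq_eq,
    pearsonStatistic, Real.norm_eq_abs, sq_abs, mul_pow, mul_pow, inv_pow,
    Real.sq_sqrt (Nat.cast_nonneg T), Real.sq_sqrt (Nat.cast_nonneg k)]
  simp only [hd]
  field_simp

end BinVector

end DMAP

theorem proposition2 {V : Type*} [Fintype V] (P : DMAP.LanguageModel V)
    (tie : List V → V → V → Prop) (htie : ∀ c, IsStrictTotalOrder V (tie c))
    (k : ℕ) (hk : 1 ≤ k)
    {Ω : ℕ → Type*} [∀ T, MeasurableSpace (Ω T)]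
    (μ : (T : ℕ) → Measure (Ω T)) [∀ T, IsProbabilityMeasure (μ T)]
    (x : (T : ℕ) → Ω T → Fin T → ℝ)
    (hx : ∀ T, HasLaw (x T) (DMAP.generatedSampleLaw P P tie T) (μ T)) :
    TendstoInDistribution (fun T ω => DMAP.pearsonStatistic k (x T ω)) atTop
      (fun y : ℝ => y) μ (DMAP.chiSquared (k - 1)) := by
  have hU : IsProbabilityMeasure (volume.restrict (Set.Ico (0 : ℝ) 1)) := ⟨by simp⟩
  simp only [DMAP.generatedSampleLaw_self P tie htie] at hx
  have hclt := (DMAP.tendstoInDistribution_inv_sqrt_smul_sum (DMAP.measurable_pointVector k)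
    (DMAP.integral_inner_pointVector hk) (DMAP.integral_inner_pointVector_sq hk) μ x
    hx).continuous_comp (g := fun y => ‖y‖ ^ 2) (by fun_prop)
  have hlaw := DMAP.map_norm_sq_stdGaussian (DMAP.finrank_zeroSum hk)
  -- The norm identity needs every point to lie in some bin, which holds only almost surely.
  have hmem (T : ℕ) : ∀ᵐ ω ∂μ T, ∀ j, x T ω j ∈ Set.Ico (0 : ℝ) 1 := by
    have h : ∀ᵐ y ∂(Measure.pi fun _ : Fin T => volume.restrict (Set.Ico (0 : ℝ) 1)),
        ∀ j, y j ∈ Set.Ico (0 : ℝ) 1 := by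
      refine ae_all_iff.2 fun j => ?_
      exact (Measure.quasiMeasurePreserving_eval _ j).ae (ae_restrict_mem measurableSet_Ico)
    rw [← (hx T).map_eq] at h
    exact ae_of_ae_map (hx T).aemeasurable h
  have hpearson := hclt.congr (Y := fun T ω => DMAP.pearsonStatistic k (x T ω)) (fun T => by
    filter_upwards [hmem T] with ω hω
    exact DMAP.norm_sq_inv_sqrt_smul_sum_pointVector hk hω) (ae_eq_refl _)
  refine ⟨hpearson.forall_aemeasurable, aemeasurable_id', ?_⟩
  -- The limit law is now the image of the standard Gaussian under the squared norm; it has to be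
  -- identified with `chiSquared (k - 1)`.
  convert hpearson.tendsto using 3
  refine congrArg _ (Subtype.ext ?_)
  exact Measure.map_id'.trans hlaw.symm
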